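/- Let $f:\mathbb R^n\to\mathbb R$ ($n\ge 1$) be Lipschitz with constant $L$, let $r_s>0$ with $r_s\to0$ as $s\to\infty$, let $D_s=\{v\in\mathbb R^n:\|v\|\le r_s\}$ (Euclidean norm), of diameter $d(D_s)$ and Lebesgue measure $\mu(D_s)$, and put $$\varphi_s(x)=\frac1{\mu(D_s)}\int_{D_s}f(x+y)\,dy,\qquad \Phi_s(x)=\frac1{\mu(D_s)}\int_{D_s}\varphi_s(x+y)\,dy .$$ Assume that $f$ and every $\Phi_s$ are bounded below and attain their infimum. (i) Every $\Phi_s$ is twice continuously differentiable, and $\|\nabla^2\Phi_s(y)\|\le 2nL/d(D_s)$ for all $y\in\mathbb R^n$. (ii) Let $C$ be a constant and let $L_s>0$ be such that $\|\nabla^2\Phi_s(y)\|\le L_s$ for all $s$ and $y$, and $L_s\le C/d(D_s)$ for all $s$ (for instance $L_s=C/d(D_s)$ with any $C>0$, $C\ge 2nL$). Put $\tilde\Phi_s(y,x)=\Phi_s(y)+L_s\|y-x\|^2$, with $\nabla$ and $\nabla^2$ taken in $y$. Let $x_0,x_1,\dots$ be a sequence constructed by the damped Newton method: at step $k$, with index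 $s=s(k)$ and $\tilde\Phi_{s,k}=\tilde\Phi_s(\cdot,x_k)$, 1. $\Delta_k=-(\nabla^2\tilde\Phi_{s,k}(x_k))^{-1}\nabla\tilde\Phi_{s,k}(x_k)$; 2. $l_k$ is a non-negative integer with $\tilde\Phi_{s,k}(x_k+2^{-l_k}\Delta_k)\le\tilde\Phi_{s,k}(x_k)-2^{-2l_k}\frac{L_s}{2}\|\Delta_k\|^2$; 3. $x_{k+1}=x_k+2^{-l_k}\Delta_k$; 4. as $k$ grows, the sets $D_{s(k)}$ are shrunk, $s(k)\to\infty$, in such a way that $3\|\Delta_k\|/d(D_{s(k)})<\varepsilon_k$ for all $k$, for some sequence $\varepsilon_k\to+0$. Then every limit point $x_*$ of $(x_k)$ (limit of a subsequence) is a Clarke-stationary point of $f$: $0\in\partial_{CL}f(x_*)$, that is, $\limsup_{y\to x_*,\,t\downarrow0}\frac{f(y+tv)-f(y)}{t}\ge0$ for all $v\in\mathbb R^n$. -/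

import Mathlib

open MeasureTheory Filter Topology

noncomputable section

/-- The integral average `x ↦ μ(D)⁻¹ ∫_D g (x + y) dy` of `g` over the translates of `D`. -/
def setMean {n : ℕ} (D : Set (EuclideanSpace ℝ (Fin n))) (g : EuclideanSpace ℝ (Fin n) → ℝ)
    (x : EuclideanSpace ℝ (Fin n)) : ℝ :=
  (volume.real D)⁻¹ * ∫ y in D, g (x + y)

/-- The doubly averaged function `Φ`: the average over `D` of the average of `f` over `D`. -/
def doubleMean {n : ℕ} (D : Set (EuclideanSpace ℝ (Fin n))) (f : EuclideanSpace ℝ (Fin n) → ℝ) :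
    EuclideanSpace ℝ (Fin n) → ℝ :=
  setMean D (setMean D f)

/-- The closed ball of radius `ρ` centred at the origin of `ℝⁿ`. -/
def originBall (n : ℕ) (ρ : ℝ) : Set (EuclideanSpace ℝ (Fin n)) :=
  Metric.closedBall 0 ρ

/-- The regularized function `y ↦ Φ(y) + K ‖y - x‖²`. -/
def regularized {n : ℕ} (Φ : EuclideanSpace ℝ (Fin n) → ℝ) (K : ℝ)
    (x y : EuclideanSpace ℝ (Fin n)) : ℝ :=
  Φ y + K * ‖y - x‖ ^ 2

/-- The Hessian of `g` at `y`, as a linear operator on `ℝⁿ` (the derivative of the gradient);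
its norm is the operator norm of the matrix of second derivatives. -/
def hessian {n : ℕ} (g : EuclideanSpace ℝ (Fin n) → ℝ) (y : EuclideanSpace ℝ (Fin n)) :
    EuclideanSpace ℝ (Fin n) →L[ℝ] EuclideanSpace ℝ (Fin n) :=
  fderiv ℝ (gradient g) y

/-- Clarke's generalized directional derivative
`f°(x; v) = limsup_{y → x, t ↓ 0} (f (y + t v) - f y) / t`. -/
def clarkeDeriv {n : ℕ} (f : EuclideanSpace ℝ (Fin n) → ℝ)
    (x v : EuclideanSpace ℝ (Fin n)) : ℝ :=
  limsup (fun p : EuclideanSpace ℝ (Fin n) × ℝ => (f (p.1 + p.2 • v) - f p.1) / p.2)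
    (𝓝 x ×ˢ 𝓝[>] (0 : ℝ))

/-- The Clarke subdifferential of a (locally) Lipschitz function. -/
def clarkeSubdifferential {n : ℕ} (f : EuclideanSpace ℝ (Fin n) → ℝ)
    (x : EuclideanSpace ℝ (Fin n)) : Set (EuclideanSpace ℝ (Fin n)) :=
  {ξ | ∀ v, inner ℝ ξ v ≤ clarkeDeriv f x v}

/-- `x` is an (infinite) run of the damped Newton method on the doubly averaged functions over the
balls of radii `r s`, with regularization constants `K s`. At step `k` the ball with index `s k`
is in use, `Δ k` is the Newton direction, `2 ^ (-l k)` the step length, and `ε` is the sequence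
that controls the shrinking of the balls. -/
structure IsDampedNewtonRun {n : ℕ} (f : EuclideanSpace ℝ (Fin n) → ℝ) (r K : ℕ → ℝ)
    (s l : ℕ → ℕ) (ε : ℕ → ℝ) (x Δ : ℕ → EuclideanSpace ℝ (Fin n)) : Prop where
  direction : ∀ k, Δ k =
    -(hessian (regularized (doubleMean (originBall n (r (s k))) f) (K (s k)) (x k)) (x k)).inverse
      (gradient (regularized (doubleMean (originBall n (r (s k))) f) (K (s k)) (x k)) (x k))
  descent : ∀ k,
    regularized (doubleMean (originBall n (r (s k))) f) (K (s k)) (x k)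
        (x k + ((2 : ℝ) ^ l k)⁻¹ • Δ k) ≤
      regularized (doubleMean (originBall n (r (s k))) f) (K (s k)) (x k) (x k)
        - ((2 : ℝ) ^ (2 * l k))⁻¹ * (K (s k) / 2) * ‖Δ k‖ ^ 2
  update : ∀ k, x (k + 1) = x k + ((2 : ℝ) ^ l k)⁻¹ • Δ k
  index_tendsto : Tendsto s atTop atTop
  eps_tendsto : Tendsto ε atTop (𝓝 0)
  shrink : ∀ k, 3 * ‖Δ k‖ / Metric.diam (originBall n (r (s k))) < ε k

end

/-! ### Averages over balls: one averaging gains one derivative. -/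

section BallMean

/-! By Rademacher, the derivative of a ball average of a Lipschitz function is the average of its
a.e. derivative. That derivative is only bounded, but averaging a bounded function over balls of
radius `ρ` gives a Lipschitz one, as translating a ball changes little volume
(`norm_vectorMean_sub_le`). So one average is C¹ with Lipschitz derivative, two are C², and the
Hessian is at most `n * L / ρ`.

For the Newton run, the regularized Hessian is at most `3 * K` in norm, so `‖∇Φ (x k)‖ ≤ 3 * K * ‖Δ
k‖ ≤ C * ε k → 0`. If Clarke's derivative at a limit point were negative along `v`, then `f` would
descend along `v` at a uniform rate nearby, and so would its averages over small balls
(`exists_inner_gradient_doubleMean_le`). This keeps `⟪∇Φ (x k), v⟫` below a negative constant for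
arbitrarily late `k`, a contradiction. -/

lemma integrableOn_closedBall_of_bounded {n : ℕ} {F : Type*} [NormedAddCommGroup F]
    {h : EuclideanSpace ℝ (Fin n) → F} {M : ℝ} (hm : AEStronglyMeasurable h volume)
    (hM : ∀ y, ‖h y‖ ≤ M) (x : EuclideanSpace ℝ (Fin n)) (ρ : ℝ) :
    IntegrableOn h (Metric.closedBall x ρ) :=
  Measure.integrableOn_of_bounded measure_closedBall_lt_top.ne hm (M := M)
    (Eventually.of_forall hM)

variable {n : ℕ} {F : Type*} [NormedAddCommGroup F] [NormedSpace ℝ F]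

/-- The average `x ↦ μ(D)⁻¹ ∫_D g (x + y) dy` of a vector-valued function over the translates of
`D`. -/
noncomputable def vectorMean (D : Set (EuclideanSpace ℝ (Fin n))) (g : EuclideanSpace ℝ (Fin n) → F)
    (x : EuclideanSpace ℝ (Fin n)) : F :=
  (volume.real D)⁻¹ • ∫ y in D, g (x + y)

lemma vectorMean_eq_setMean (D : Set (EuclideanSpace ℝ (Fin n)))
    (g : EuclideanSpace ℝ (Fin n) → ℝ) : vectorMean D g = setMean D g := rfl

lemma volume_real_originBall_pos {ρ : ℝ} (hρ : 0 < ρ) : 0 < volume.real (originBall n ρ) :=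
  ENNReal.toReal_pos (Metric.measure_closedBall_pos volume _ hρ).ne'
    measure_closedBall_lt_top.ne

lemma isCompact_originBall (n : ℕ) (ρ : ℝ) : IsCompact (originBall n ρ) :=
  isCompact_closedBall _ _

lemma setIntegral_originBall_add (ρ : ℝ) (h : EuclideanSpace ℝ (Fin n) → F)
    (x : EuclideanSpace ℝ (Fin n)) :
    ∫ y in originBall n ρ, h (x + y) = ∫ y in Metric.closedBall x ρ, h y := by
  have := (measurePreserving_add_left (volume : Measure (EuclideanSpace ℝ (Fin n))) x
    ).setIntegral_preimage_emb (MeasurableEquiv.addLeft x).measurableEmbedding h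
    (Metric.closedBall x ρ)
  rw [← this]
  congr 2
  ext y
  simp [originBall]

lemma volume_real_closedBall (x : EuclideanSpace ℝ (Fin n)) {ρ : ℝ} (hρ : 0 ≤ ρ) :
    volume.real (Metric.closedBall x ρ) =
      ρ ^ n * volume.real (Metric.closedBall (0 : EuclideanSpace ℝ (Fin n)) 1) := by
  simpa using Measure.addHaar_real_closedBall' (volume : Measure (EuclideanSpace ℝ (Fin n))) x hρ

/-- The intersection contains the ball about the midpoint of radius `ρ * (1 - u)`, `u = ‖x - z‖ / (2
* ρ)`; Bernoulli gives `(1 - u) ^ n ≥ 1 - n * u`. -/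
lemma volume_real_closedBall_sub_inter_le {ρ : ℝ} (hρ : 0 < ρ) (x z : EuclideanSpace ℝ (Fin n))
    (hxz : ‖x - z‖ ≤ 2 * ρ) :
    volume.real (Metric.closedBall x ρ) -
        volume.real (Metric.closedBall x ρ ∩ Metric.closedBall z ρ) ≤
      n * ‖x - z‖ / (2 * ρ) * volume.real (originBall n ρ) := by
  set ω := volume.real (Metric.closedBall (0 : EuclideanSpace ℝ (Fin n)) 1)
  have hω : 0 ≤ ω := measureReal_nonneg
  have hsub : Metric.closedBall (midpoint ℝ x z) (ρ - ‖x - z‖ / 2) ⊆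
      Metric.closedBall x ρ ∩ Metric.closedBall z ρ := by
    apply Set.subset_inter <;> apply Metric.closedBall_subset_closedBall'
    · rw [dist_midpoint_left, dist_eq_norm]
      norm_num
      linarith
    · rw [dist_midpoint_right, dist_eq_norm]
      norm_num
      linarith
  have hmono := measureReal_mono (μ := volume) hsub
    (measure_ne_top_of_subset Set.inter_subset_left measure_closedBall_lt_top.ne)
  rw [volume_real_closedBall _ (by linarith)] at hmono
  rw [originBall, volume_real_closedBall _ hρ.le, volume_real_closedBall _ hρ.le]
  set u := ‖x - z‖ / (2 * ρ) with hu
  have hu1 : u ≤ 1 := by rw [hu, div_le_one (by positivity)]; exact hxz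
  have hbern : 1 + (n : ℝ) * (-u) ≤ (1 + -u) ^ n :=
    one_add_mul_le_pow (by linarith) n
  have hfac : ρ - ‖x - z‖ / 2 = ρ * (1 + -u) := by rw [hu]; field_simp; ring
  rw [hfac, mul_pow] at hmono
  have h1 := mul_le_mul_of_nonneg_left hbern (mul_nonneg (pow_nonneg hρ.le n) hω)
  have h2 : (n : ℝ) * ‖x - z‖ / (2 * ρ) = n * u := by rw [hu]; ring
  rw [h2]
  nlinarith

variable {h : EuclideanSpace ℝ (Fin n) → F} {M : ℝ}

lemma norm_setIntegral_closedBall_diff_le (hM : ∀ y, ‖h y‖ ≤ M) {ρ : ℝ} (hρ : 0 < ρ)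
    (x z : EuclideanSpace ℝ (Fin n)) (hxz : ‖x - z‖ ≤ 2 * ρ) :
    ‖∫ y in Metric.closedBall x ρ \ Metric.closedBall z ρ, h y‖ ≤
      M * (n * ‖x - z‖ / (2 * ρ) * volume.real (originBall n ρ)) := by
  have hM0 : 0 ≤ M := (norm_nonneg _).trans (hM 0)
  refine (norm_setIntegral_le_of_norm_le_const (C := M)
    (measure_lt_top_of_subset Set.sdiff_subset measure_closedBall_lt_top.ne)
    fun y _ => hM y).trans ?_
  gcongr
  refine le_trans (le_of_eq ?_) (volume_real_closedBall_sub_inter_le hρ x z hxz)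
  rw [eq_sub_iff_add_eq]
  exact measureReal_sdiff_add_inter measurableSet_closedBall measure_closedBall_lt_top.ne

lemma norm_vectorMean_le (hM : ∀ y, ‖h y‖ ≤ M) {ρ : ℝ} (hρ : 0 < ρ)
    (x : EuclideanSpace ℝ (Fin n)) : ‖vectorMean (originBall n ρ) h x‖ ≤ M := by
  have hV := volume_real_originBall_pos (n := n) hρ
  have := norm_setIntegral_le_of_norm_le_const (μ := volume) (s := originBall n ρ)
    (f := fun y => h (x + y)) (C := M) (isCompact_originBall n ρ).measure_lt_top
    fun y _ => hM _
  rw [vectorMean, norm_smul, norm_inv, Real.norm_of_nonneg hV.le, inv_mul_le_iff₀ hV]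
  linarith

/-- The average of a bounded function over balls of radius `ρ` is Lipschitz. -/
lemma norm_vectorMean_sub_le (hm : AEStronglyMeasurable h volume) (hM : ∀ y, ‖h y‖ ≤ M)
    {ρ : ℝ} (hρ : 0 < ρ) (x z : EuclideanSpace ℝ (Fin n)) :
    ‖vectorMean (originBall n ρ) h x - vectorMean (originBall n ρ) h z‖ ≤
      n * M / ρ * ‖x - z‖ := by
  have hM0 : 0 ≤ M := (norm_nonneg _).trans (hM 0)
  have hV := volume_real_originBall_pos (n := n) hρ
  rcases le_or_gt ‖x - z‖ (2 * ρ) with hxz | hxz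
  · have hx := integrableOn_closedBall_of_bounded hm hM x ρ
    have hz := integrableOn_closedBall_of_bounded hm hM z ρ
    -- The common part cancels; each of the two crescents contributes half of the constant.
    have hI : (∫ y in Metric.closedBall x ρ, h y) - ∫ y in Metric.closedBall z ρ, h y =
        (∫ y in Metric.closedBall x ρ \ Metric.closedBall z ρ, h y) -
          ∫ y in Metric.closedBall z ρ \ Metric.closedBall x ρ, h y := by
      rw [← integral_inter_add_sdiff measurableSet_closedBall hx (t := Metric.closedBall z ρ),
        ← integral_inter_add_sdiff measurableSet_closedBall hz (t := Metric.closedBall x ρ),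
        Set.inter_comm]
      abel
    have h1 := norm_setIntegral_closedBall_diff_le hM hρ x z hxz
    have h2 := norm_setIntegral_closedBall_diff_le hM hρ z x (by rwa [norm_sub_rev])
    rw [norm_sub_rev z x] at h2
    rw [vectorMean, vectorMean, ← smul_sub, setIntegral_originBall_add,
      setIntegral_originBall_add, hI, norm_smul, norm_inv, Real.norm_of_nonneg hV.le,
      inv_mul_le_iff₀ hV]
    refine (norm_sub_le _ _).trans ((add_le_add h1 h2).trans (le_of_eq ?_))
    field_simp
    ring
  -- For distant centres the trivial bound `2 * M` suffices, provided `n ≥ 1`; for `n = 0` the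
  -- centres coincide.
  · have hn : 1 ≤ n := by
      rcases Nat.eq_zero_or_pos n with rfl | hn
      · rw [Subsingleton.elim x z] at hxz
        simp at hxz
        linarith
      · exact hn
    have hn' : (1 : ℝ) ≤ n := by exact_mod_cast hn
    have h1 := norm_vectorMean_le hM hρ x
    have h2 := norm_vectorMean_le hM hρ z
    calc _ ≤ M + M := (norm_sub_le _ _).trans (add_le_add h1 h2)
      _ = 1 * M / ρ * (2 * ρ) := by field_simp; ring
      _ ≤ n * M / ρ * ‖x - z‖ := by gcongr

variable {g : EuclideanSpace ℝ (Fin n) → F} {L : NNReal}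

lemma vectorMean_lipschitzWith (hg : LipschitzWith L g) {ρ : ℝ} (hρ : 0 < ρ) :
    LipschitzWith L (vectorMean (originBall n ρ) g) := by
  have hV := volume_real_originBall_pos (n := n) hρ
  refine LipschitzWith.of_dist_le_mul fun x z => ?_
  have hint : ∀ x, IntegrableOn (fun y => g (x + y)) (originBall n ρ) := fun x =>
    (hg.continuous.comp (by fun_prop)).continuousOn.integrableOn_compact (isCompact_originBall n ρ)
  rw [dist_eq_norm, dist_eq_norm, vectorMean, vectorMean, ← smul_sub,
    ← integral_sub (hint x) (hint z), norm_smul, norm_inv, Real.norm_of_nonneg hV.le,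
    inv_mul_le_iff₀ hV, mul_comm]
  refine norm_setIntegral_le_of_norm_le_const (isCompact_originBall n ρ).measure_lt_top
    fun y _ => ?_
  simpa using hg.norm_sub_le (x + y) (z + y)

variable [FiniteDimensional ℝ F]

/-- A Lipschitz function may be differentiated under the averaging operator. -/
lemma hasFDerivAt_vectorMean (hg : LipschitzWith L g) (ρ : ℝ) (x : EuclideanSpace ℝ (Fin n)) :
    HasFDerivAt (vectorMean (originBall n ρ) g) (vectorMean (originBall n ρ) (fderiv ℝ g) x) x := by
  have : CompleteSpace F := FiniteDimensional.complete ℝ F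
  have hmp := measurePreserving_add_left (volume : Measure (EuclideanSpace ℝ (Fin n))) x
  have hd : ∀ᵐ y ∂(volume : Measure (EuclideanSpace ℝ (Fin n))), DifferentiableAt ℝ g (x + y) :=
    hmp.quasiMeasurePreserving.ae hg.ae_differentiableAt
  have hcont : ∀ z, Continuous fun y => g (z + y) := fun z => hg.continuous.comp (by fun_prop)
  refine HasFDerivAt.const_smul (hasFDerivAt_integral_of_dominated_loc_of_lip
    (F := fun z y => g (z + y)) (F' := fun y => fderiv ℝ g (x + y)) (bound := fun _ => (L : ℝ))
    univ_mem (Eventually.of_forall fun z => (hcont z).aestronglyMeasurable)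
    ((hcont x).continuousOn.integrableOn_compact (isCompact_originBall n ρ)) ?_ ?_ ?_ ?_).2 _
  · let _ : MeasurableSpace F := borel F
    have : BorelSpace F := ⟨rfl⟩
    have := FiniteDimensional.proper_real F
    exact ((measurable_fderiv ℝ g).comp (measurable_const_add x)).aestronglyMeasurable
  · refine Eventually.of_forall fun y => ?_
    have : Real.nnabs (L : ℝ) = L := by simp
    rw [this]
    have h2 := hg.comp (LipschitzWith.id.add (LipschitzWith.const y))
    simpa [Function.comp_def] using h2
  · exact integrableOn_const (isCompact_originBall n ρ).measure_lt_top.ne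
  · refine ae_restrict_of_ae (hd.mono fun y hy => ?_)
    exact (hasFDerivAt_comp_add_right y).2 hy.hasFDerivAt

lemma fderiv_vectorMean (hg : LipschitzWith L g) (ρ : ℝ) :
    fderiv ℝ (vectorMean (originBall n ρ) g) = vectorMean (originBall n ρ) (fderiv ℝ g) :=
  funext fun x => (hasFDerivAt_vectorMean hg ρ x).fderiv

lemma lipschitzWith_fderiv_vectorMean (hg : LipschitzWith L g) {ρ : ℝ} (hρ : 0 < ρ) :
    LipschitzWith (n * L / ρ).toNNReal (fderiv ℝ (vectorMean (originBall n ρ) g)) := by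
  have : CompleteSpace F := FiniteDimensional.complete ℝ F
  have hm : AEStronglyMeasurable (fderiv ℝ g) (volume : Measure (EuclideanSpace ℝ (Fin n))) := by
    let _ : MeasurableSpace F := borel F
    have : BorelSpace F := ⟨rfl⟩
    have := FiniteDimensional.proper_real F
    exact (measurable_fderiv ℝ g).aestronglyMeasurable
  rw [fderiv_vectorMean hg]
  refine LipschitzWith.of_dist_le_mul fun x z => ?_
  rw [dist_eq_norm, dist_eq_norm, Real.coe_toNNReal _ (by positivity)]
  -- The bound holds at every point, since `fderiv` is `0` where `g` is not differentiable.
  exact norm_vectorMean_sub_le hm (fun y => norm_fderiv_le_of_lipschitz ℝ hg) hρ x z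

lemma contDiff_one_vectorMean (hg : LipschitzWith L g) {ρ : ℝ} (hρ : 0 < ρ) :
    ContDiff ℝ 1 (vectorMean (originBall n ρ) g) :=
  contDiff_one_iff_fderiv.2 ⟨fun x => (hasFDerivAt_vectorMean hg ρ x).differentiableAt,
    (lipschitzWith_fderiv_vectorMean hg hρ).continuous⟩

end BallMean

/-! ### Smoothness and Hessian bound of the double average. -/

section DoubleMean

variable {n : ℕ} {f : EuclideanSpace ℝ (Fin n) → ℝ} {L : NNReal}

lemma setMean_lipschitzWith (hf : LipschitzWith L f) {ρ : ℝ} (hρ : 0 < ρ) :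
    LipschitzWith L (setMean (originBall n ρ) f) := by
  rw [← vectorMean_eq_setMean]
  exact vectorMean_lipschitzWith hf hρ

lemma fderiv_doubleMean (hf : LipschitzWith L f) {ρ : ℝ} (hρ : 0 < ρ) :
    fderiv ℝ (doubleMean (originBall n ρ) f) =
      vectorMean (originBall n ρ) (fderiv ℝ (setMean (originBall n ρ) f)) := by
  rw [doubleMean, ← vectorMean_eq_setMean _ (setMean _ f)]
  exact fderiv_vectorMean (setMean_lipschitzWith hf hρ) ρ

lemma differentiable_doubleMean (hf : LipschitzWith L f) {ρ : ℝ} (hρ : 0 < ρ) :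
    Differentiable ℝ (doubleMean (originBall n ρ) f) := by
  rw [doubleMean, ← vectorMean_eq_setMean _ (setMean _ f)]
  exact fun x => (hasFDerivAt_vectorMean (setMean_lipschitzWith hf hρ) ρ x).differentiableAt

lemma contDiff_two_doubleMean (hf : LipschitzWith L f) {ρ : ℝ} (hρ : 0 < ρ) :
    ContDiff ℝ 2 (doubleMean (originBall n ρ) f) := by
  have h1 : ContDiff ℝ 1 (fderiv ℝ (doubleMean (originBall n ρ) f)) := by
    rw [fderiv_doubleMean hf hρ]
    have := lipschitzWith_fderiv_vectorMean hf hρ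
    rw [vectorMean_eq_setMean] at this
    exact contDiff_one_vectorMean this hρ
  have h2 := (contDiff_succ_iff_fderiv (𝕜 := ℝ) (n := 1)
    (f := doubleMean (originBall n ρ) f)).2 ⟨differentiable_doubleMean hf hρ, by simp, h1⟩
  simpa [one_add_one_eq_two] using h2

lemma lipschitzWith_fderiv_doubleMean (hf : LipschitzWith L f) {ρ : ℝ} (hρ : 0 < ρ) :
    LipschitzWith (n * L / ρ).toNNReal (fderiv ℝ (doubleMean (originBall n ρ) f)) := by
  have := lipschitzWith_fderiv_vectorMean hf hρ
  rw [vectorMean_eq_setMean] at this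
  rw [fderiv_doubleMean hf hρ]
  exact vectorMean_lipschitzWith this hρ

lemma norm_hessian_doubleMean_le (hf : LipschitzWith L f) {ρ : ℝ} (hρ : 0 < ρ)
    (y : EuclideanSpace ℝ (Fin n)) :
    ‖hessian (doubleMean (originBall n ρ) f) y‖ ≤
      2 * n * L / Metric.diam (originBall n ρ) := by
  rcases Nat.eq_zero_or_pos n with rfl | hn
  -- In dimension `0` the diameter is not `2 * ρ`, but the Hessian vanishes.
  · rw [Subsingleton.elim (hessian (doubleMean (originBall 0 ρ) f) y) 0]
    simp
  · have : Nonempty (Fin n) := ⟨⟨0, hn⟩⟩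
    rw [originBall, Metric.diam_closedBall_eq _ hρ.le, ← originBall]
    have hl : LipschitzWith (n * L / ρ).toNNReal (gradient (doubleMean (originBall n ρ) f)) := by
      have := (InnerProductSpace.toDual ℝ (EuclideanSpace ℝ (Fin n))).symm.lipschitz.comp
        (lipschitzWith_fderiv_doubleMean hf hρ)
      rwa [one_mul] at this
    have := norm_fderiv_le_of_lipschitz ℝ hl (x₀ := y)
    rw [Real.coe_toNNReal _ (by positivity)] at this
    exact this.trans (le_of_eq (by field_simp))

end DoubleMean

/-! ### The Newton direction controls the gradient. -/

section Newton

variable {n : ℕ} {Φ : EuclideanSpace ℝ (Fin n) → ℝ}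

lemma gradient_regularized (hΦ : Differentiable ℝ Φ) (K : ℝ) (x : EuclideanSpace ℝ (Fin n)) :
    gradient (regularized Φ K x) = fun y => gradient Φ y + (2 * K) • (y - x) := by
  refine gradient_eq fun y => ?_
  have h1 := (hΦ y).hasGradientAt.hasFDerivAt
  have h2 : HasFDerivAt (fun y => ‖y - x‖ ^ 2) (2 • (innerSL ℝ (y - x))) y := by
    simpa using ((hasFDerivAt_id y).sub_const x).norm_sq
  rw [hasGradientAt_iff_hasFDerivAt]
  refine (h1.add (h2.const_mul K)).congr_fderiv ?_
  ext v
  simp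
  ring

lemma hessian_regularized (hΦ : ContDiff ℝ 2 Φ) (K : ℝ) (x y : EuclideanSpace ℝ (Fin n)) :
    hessian (regularized Φ K x) y = hessian Φ y + (2 * K) • ContinuousLinearMap.id ℝ _ := by
  have hd : Differentiable ℝ (gradient Φ) := by
    have h1 : Differentiable ℝ (fderiv ℝ Φ) :=
      (hΦ.fderiv_right (m := 1) (by norm_num)).differentiable (by simp)
    exact (InnerProductSpace.toDual ℝ (EuclideanSpace ℝ (Fin n))).symm.differentiable.comp h1
  rw [hessian, gradient_regularized (hΦ.differentiable (by simp))]
  exact ((hd y).hasFDerivAt.add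
    (((hasFDerivAt_id y).sub_const x).const_smul (2 * K))).fderiv

/-- Neumann series: after factoring out `2 * K`, the perturbation of the identity has norm at most
`1 / 2`. -/
lemma isUnit_add_smul_id {E : Type*} [NormedAddCommGroup E] [NormedSpace ℝ E] [CompleteSpace E]
    {H : E →L[ℝ] E} {K : ℝ} (hK : 0 < K) (hH : ‖H‖ ≤ K) :
    IsUnit (H + (2 * K) • ContinuousLinearMap.id ℝ E) := by
  have h1 : ‖-((2 * K)⁻¹ • H)‖ < 1 := by
    rw [norm_neg, norm_smul, Real.norm_of_nonneg (by positivity), inv_mul_lt_iff₀ (by positivity)]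
    linarith
  have h2 := (Units.mk0 (2 * K) (by positivity)).isUnit.map (algebraMap ℝ (E →L[ℝ] E)) |>.mul
    (isUnit_one_sub_of_norm_lt_one h1)
  convert h2 using 1
  ext v
  have : K ≠ 0 := hK.ne'
  simp [Algebra.algebraMap_eq_smul_one, smul_smul]
  rw [← mul_assoc, mul_assoc 2, mul_inv_cancel₀ this]
  simp [add_comm]

/-- The gradient is controlled by the regularized Newton step. -/
lemma norm_gradient_le_of_newton_direction (hΦ : ContDiff ℝ 2 Φ) {K : ℝ} (hK : 0 < K)
    {x Δ : EuclideanSpace ℝ (Fin n)} (hH : ‖hessian Φ x‖ ≤ K)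
    (hΔ : Δ = -(hessian (regularized Φ K x) x).inverse (gradient (regularized Φ K x) x)) :
    ‖gradient Φ x‖ ≤ 3 * K * ‖Δ‖ := by
  rw [hessian_regularized hΦ, gradient_regularized (hΦ.differentiable (by simp))] at hΔ
  simp only [sub_self, smul_zero, add_zero] at hΔ
  -- Invertibility ensures that `inverse` is a true inverse, not the default `0`.
  have hT := Ring.mul_inverse_cancel _ (isUnit_add_smul_id hK hH)
  rw [ContinuousLinearMap.ringInverse_eq_inverse] at hT
  set T := hessian Φ x + (2 * K) • ContinuousLinearMap.id ℝ (EuclideanSpace ℝ (Fin n)) with hTdef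
  have hg : gradient Φ x = -T Δ := by
    have := congrArg (fun A : EuclideanSpace ℝ (Fin n) →L[ℝ] _ => A (gradient Φ x)) hT
    simp only [mul_apply_eq_comp, one_apply_eq_self] at this
    rw [hΔ, map_neg, neg_neg, this]
  have h2 : ‖T Δ‖ ≤ ‖hessian Φ x‖ * ‖Δ‖ + 2 * K * ‖Δ‖ := by
    refine (norm_add_le _ _).trans (add_le_add (ContinuousLinearMap.le_opNorm _ _) ?_)
    simp [norm_smul, abs_of_pos hK]
  rw [hg, norm_neg]
  nlinarith [norm_nonneg Δ]

end Newton

/-! ### Descent of `f` passes to its double averages. -/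

section Clarke

variable {n : ℕ} {f : EuclideanSpace ℝ (Fin n) → ℝ} {L : NNReal}

lemma setMean_le_setMean_add {g : EuclideanSpace ℝ (Fin n) → ℝ} (hg : Continuous g)
    {ρ : ℝ} (hρ : 0 < ρ) {x z : EuclideanSpace ℝ (Fin n)} {c : ℝ}
    (h : ∀ y ∈ originBall n ρ, g (x + y) ≤ g (z + y) + c) :
    setMean (originBall n ρ) g x ≤ setMean (originBall n ρ) g z + c := by
  have hV := volume_real_originBall_pos (n := n) hρ
  have hint : ∀ x, IntegrableOn (fun y => g (x + y)) (originBall n ρ) := fun x =>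
    (hg.comp (by fun_prop)).continuousOn.integrableOn_compact (isCompact_originBall n ρ)
  have hc : IntegrableOn (fun _ : EuclideanSpace ℝ (Fin n) => c) (originBall n ρ) :=
    integrableOn_const (isCompact_originBall n ρ).measure_lt_top.ne
  have hm := setIntegral_mono_on (hint x) ((hint z).add hc)
    (isCompact_originBall n ρ).measurableSet h
  simp only [Pi.add_apply] at hm
  rw [integral_add (hint z) hc, setIntegral_const, smul_eq_mul] at hm
  rw [setMean, setMean, inv_mul_le_iff₀ hV, mul_add, mul_inv_cancel_left₀ hV.ne']
  exact hm

/-- If `f` descends at rate at least `δ` in the direction `v` on a neighbourhood of `x`, so does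
its double mean. -/
lemma inner_gradient_doubleMean_le (hf : LipschitzWith L f) {ρ : ℝ} (hρ : 0 < ρ)
    {x v : EuclideanSpace ℝ (Fin n)} {c τ : ℝ} (hτ : 0 < τ)
    (h : ∀ y, dist y x ≤ 2 * ρ → ∀ t ∈ Set.Ioo 0 τ, f (y + t • v) ≤ f y + t * c) :
    inner ℝ (gradient (doubleMean (originBall n ρ) f) x) v ≤ c := by
  have hd := differentiable_doubleMean hf hρ
  have hslope : ∀ t ∈ Set.Ioo 0 τ, doubleMean (originBall n ρ) f (x + t • v) ≤
      doubleMean (originBall n ρ) f x + t * c := by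
    intro t ht
    refine setMean_le_setMean_add (setMean_lipschitzWith hf hρ).continuous hρ fun y hy => ?_
    refine setMean_le_setMean_add hf.continuous hρ fun z hz => ?_
    -- The double average samples `f` at `x + y + z` with `‖y + z‖ ≤ 2 * ρ`.
    have := h (x + y + z) ?_ t ht
    · convert this using 2
      abel
    · rw [originBall, mem_closedBall_zero_iff] at hy hz
      rw [dist_eq_norm, add_assoc, add_sub_cancel_left]
      linarith [norm_add_le y z]
  have h1 : HasDerivAt (fun t : ℝ => doubleMean (originBall n ρ) f (x + t • v))
      (fderiv ℝ (doubleMean (originBall n ρ) f) x v) 0 := (hd x).hasFDerivAt.hasLineDerivAt v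
  have h2 := h1.tendsto_slope_zero_right
  have h3 : inner ℝ (gradient (doubleMean (originBall n ρ) f) x) v =
      fderiv ℝ (doubleMean (originBall n ρ) f) x v := by
    simp [gradient]
  rw [h3]
  refine le_of_tendsto h2 ?_
  filter_upwards [Ioo_mem_nhdsGT hτ] with t ht
  have := hslope t ht
  simp only [zero_add, zero_smul, add_zero, smul_eq_mul]
  rw [inv_mul_le_iff₀ ht.1]
  linarith

/-- A real-valued `limsup` yields eventual upper bounds only for functions bounded above; here `L *
‖v‖` is a bound. -/
lemma isBoundedUnder_differenceQuotient (hf : LipschitzWith L f)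
    (x v : EuclideanSpace ℝ (Fin n)) :
    (𝓝 x ×ˢ 𝓝[>] (0 : ℝ)).IsBoundedUnder (· ≤ ·)
      (fun p : EuclideanSpace ℝ (Fin n) × ℝ => (f (p.1 + p.2 • v) - f p.1) / p.2) := by
  refine isBoundedUnder_of_eventually_le (a := L * ‖v‖) ?_
  have : ∀ᶠ p in 𝓝 x ×ˢ 𝓝[>] (0 : ℝ), 0 < p.2 :=
    tendsto_snd.eventually (self_mem_nhdsWithin : Set.Ioi (0 : ℝ) ∈ 𝓝[>] (0 : ℝ))
  filter_upwards [this] with p hp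
  rw [div_le_iff₀ hp]
  have h1 := (le_abs_self _).trans (hf.norm_sub_le (p.1 + p.2 • v) p.1)
  rw [add_sub_cancel_left, norm_smul, Real.norm_of_nonneg hp.le] at h1
  linarith

/-- A negative Clarke derivative forces uniform descent of the double means over small balls. -/
lemma exists_inner_gradient_doubleMean_le (hf : LipschitzWith L f)
    {x v : EuclideanSpace ℝ (Fin n)} {c : ℝ} (hc : clarkeDeriv f x v < c) :
    ∃ η > 0, ∀ y, dist y x < η → ∀ ρ, 0 < ρ → ρ < η →
      inner ℝ (gradient (doubleMean (originBall n ρ) f) y) v ≤ c := by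
  have hev := eventually_lt_of_limsup_lt hc (isBoundedUnder_differenceQuotient hf x v)
  obtain ⟨P, hP, Q, hQ, hPQ⟩ := eventually_prod_iff.1 hev
  obtain ⟨η, hη, hηP⟩ := Metric.eventually_nhds_iff.1 hP
  obtain ⟨τ, hτ, hτQ⟩ := mem_nhdsGT_iff_exists_Ioo_subset.1 hQ
  -- A third, because `dist z x ≤ 2 * ρ + dist y x` must stay below `η`.
  refine ⟨η / 3, by positivity, fun y hy ρ hρ hρη => ?_⟩
  refine inner_gradient_doubleMean_le hf hρ hτ fun z hz t ht => ?_
  have h1 := hPQ (hηP (show dist z x < η by linarith [dist_triangle z y x])) (hτQ ht)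
  rw [div_lt_iff₀ ht.1] at h1
  linarith

end Clarke

theorem IsDampedNewtonRun.zero_mem_clarkeSubdifferential {n : ℕ}
    {f : EuclideanSpace ℝ (Fin n) → ℝ} {L : NNReal} (hf : LipschitzWith L f)
    {r : ℕ → ℝ} (hr_pos : ∀ s, 0 < r s) (hr_lim : Tendsto r atTop (𝓝 0))
    {C : ℝ} {K : ℕ → ℝ} (hK : ∀ s, 0 < K s)
    (hH : ∀ s y, ‖hessian (doubleMean (originBall n (r s)) f) y‖ ≤ K s)
    (hKC : ∀ s, K s ≤ C / Metric.diam (originBall n (r s)))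
    {s l : ℕ → ℕ} {ε : ℕ → ℝ} {x Δ : ℕ → EuclideanSpace ℝ (Fin n)}
    (hrun : IsDampedNewtonRun f r K s l ε x Δ) {xstar : EuclideanSpace ℝ (Fin n)}
    (hx : MapClusterPt xstar atTop x) : 0 ∈ clarkeSubdifferential f xstar := by
  have hC : 0 < C := by
    by_contra! hC
    exact absurd ((hK 0).trans_le (hKC 0))
      (not_lt.2 (div_nonpos_of_nonpos_of_nonneg hC Metric.diam_nonneg))
  have hgrad : ∀ k, ‖gradient (doubleMean (originBall n (r (s k))) f) (x k)‖ ≤ C * ε k := by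
    intro k
    have h1 := norm_gradient_le_of_newton_direction (contDiff_two_doubleMean hf (hr_pos (s k)))
      (hK (s k)) (hH (s k) (x k)) (hrun.direction k)
    have h2 := mul_le_mul_of_nonneg_right (hKC (s k)) (norm_nonneg (Δ k))
    have h3 := mul_le_mul_of_nonneg_left (hrun.shrink k).le hC.le
    have h4 : C * (3 * ‖Δ k‖ / Metric.diam (originBall n (r (s k)))) =
      3 * (C / Metric.diam (originBall n (r (s k))) * ‖Δ k‖) := by ring
    linarith
  intro v
  rw [inner_zero_left]
  by_contra! hneg
  -- Halving leaves a rate that is still negative yet strictly above the Clarke derivative.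
  obtain ⟨η, hη, hdesc⟩ := exists_inner_gradient_doubleMean_le hf
    (show clarkeDeriv f xstar v < clarkeDeriv f xstar v / 2 by linarith)
  have hε : Tendsto (fun k => -(C * ε k * ‖v‖)) atTop (𝓝 0) := by
    simpa using ((hrun.eps_tendsto.const_mul C).mul_const ‖v‖).neg
  have hev : ∀ᶠ k in atTop, clarkeDeriv f xstar v / 2 < -(C * ε k * ‖v‖) ∧ r (s k) < η :=
    (hε.eventually_const_lt (by linarith)).and
      ((hr_lim.comp hrun.index_tendsto).eventually_lt_const hη)
  -- The iterates are near `xstar` only frequently, whereas the smallness of `ε k` and of the radius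
  -- holds eventually; one common `k` suffices.
  obtain ⟨k, hk, hεk, hrk⟩ := ((hx.frequently (Metric.ball_mem_nhds xstar hη)).and_eventually
    hev).exists
  have h1 := hdesc (x k) hk _ (hr_pos (s k)) hrk
  have h2 := neg_le_of_abs_le (abs_real_inner_le_norm
    (gradient (doubleMean (originBall n (r (s k))) f) (x k)) v)
  have h3 := mul_le_mul_of_nonneg_right (hgrad k) (norm_nonneg v)
  linarith

theorem theorem3 (n : ℕ) (f : EuclideanSpace ℝ (Fin n) → ℝ) (L : NNReal)
    (hf : LipschitzWith L f)
    (r : ℕ → ℝ) (hr_pos : ∀ s, 0 < r s) (hr_lim : Filter.Tendsto r Filter.atTop (nhds 0))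
    (hf_min : ∃ x₀, ∀ x, f x₀ ≤ f x)
    (hΦ_min : ∀ s, ∃ x₀, ∀ x,
      doubleMean (originBall n (r s)) f x₀ ≤ doubleMean (originBall n (r s)) f x) :
    (∀ s, ContDiff ℝ 2 (doubleMean (originBall n (r s)) f) ∧
      ∀ y, ‖hessian (doubleMean (originBall n (r s)) f) y‖
        ≤ 2 * n * L / Metric.diam (originBall n (r s))) ∧
    ∀ (C : ℝ) (K : ℕ → ℝ),
      (∀ s, 0 < K s) →
      (∀ s y, ‖hessian (doubleMean (originBall n (r s)) f) y‖ ≤ K s) →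
      (∀ s, K s ≤ C / Metric.diam (originBall n (r s))) →
      ∀ (s l : ℕ → ℕ) (ε : ℕ → ℝ) (x Δ : ℕ → EuclideanSpace ℝ (Fin n)),
        IsDampedNewtonRun f r K s l ε x Δ →
        ∀ xstar, MapClusterPt xstar Filter.atTop x → 0 ∈ clarkeSubdifferential f xstar :=
  ⟨fun s => ⟨contDiff_two_doubleMean hf (hr_pos s), norm_hessian_doubleMean_le hf (hr_pos s)⟩,
    fun _ _ hK hH hKC _ _ _ _ _ hrun _ hx =>
      hrun.zero_mem_clarkeSubdifferential hf hr_pos hr_lim hK hH hKC hx⟩
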